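/- Let $\Omega=\{\omega\in C([0,1],\mathbb R):\omega(0)=0\}$ with the supremum norm, and let $W$ be the Wiener measure on $\Omega$, i.e. the law of standard Brownian motion on $[0,1]$. For $\bar\omega\in\Omega$ and $\varepsilon>0$ let $B(\bar\omega,\varepsilon)$ be the open ball of radius $\varepsilon$ centred at $\bar\omega$, and define the lower and upper local orders of $W$ at $\bar\omega$, with values in $[0,+\infty]$, by $$\underline{\mathsf{ord}}_{\mathrm{loc}}W(\bar\omega)=\sup\Big\{\alpha>0:\ \frac{W(B(\bar\omega,\varepsilon))}{\exp(-\varepsilon^{-\alpha})}\xrightarrow[\varepsilon\to0^+]{}0\Big\},\qquad \overline{\mathsf{ord}}_{\mathrm{loc}}W(\bar\omega)=\inf\Big\{\alpha>0:\ \frac{W(B(\bar\omega,\varepsilon))}{\exp(-\varepsilon^{-\alpha})}\xrightarrow[\varepsilon\to0^+]{}+\infty\Big\}$$ (with $\sup\emptyset=0$ and $\inf\emptyset=+\infty$). Then the local orders of $W$ are at least $2$ at every path: for every $\bar\omega\in\Omega$, $$\underline{\mathsf{ord}}_{\mathrm{loc}}W(\bar\omega)\ge 2\quad\text{and}\quad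 \overline{\mathsf{ord}}_{\mathrm{loc}}W(\bar\omega)\ge 2 .$$ Consequently, for every $a\in[0,2)$ the level sets $\{\bar\omega\in\Omega:\underline{\mathsf{ord}}_{\mathrm{loc}}W(\bar\omega)=a\}$ and $\{\bar\omega\in\Omega:\overline{\mathsf{ord}}_{\mathrm{loc}}W(\bar\omega)=a\}$, and their intersection $\{\bar\omega\in\Omega:\mathsf{ord}_{\mathrm{loc}}W(\bar\omega)=a\}$, are empty. -/

import Mathlib

open MeasureTheory ProbabilityTheory Filter Topology
open scoped ENNReal unitInterval

namespace WienerOrder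

/-- The path space `Ω`: continuous functions `ω : [0,1] → ℝ` with `ω 0 = 0`, with the metric
of the supremum norm (inherited from `C([0,1], ℝ)`). -/
abbrev PathSpace : Type := {ω : C(I, ℝ) // ω 0 = 0}

instance instMeasurableSpacePathSpace : MeasurableSpace PathSpace := borel PathSpace

instance instBorelSpacePathSpace : BorelSpace PathSpace := ⟨rfl⟩

/-- The coordinate process `(ω(t))_{t ∈ [0,1]}` on the path space. -/
def coord (t : I) (ω : PathSpace) : ℝ := ω.1 t

/-- `W` is the Wiener measure on `Ω`, i.e. the law of standard Brownian motion on `[0,1]`: under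
the Borel measure `W` the coordinate process (which is continuous and starts at `0` by the choice
of `Ω`) has independent increments, and for `s ≤ t` the increment `ω(t) - ω(s)` is a centred
Gaussian variable of variance `t - s`. These properties fix the finite-dimensional laws, hence
`W`; they imply that `W` is a probability measure. -/
structure IsWienerMeasure (W : Measure PathSpace) : Prop where
  hasIndepIncrements : HasIndepIncrements coord W
  hasLaw_increment : ∀ s t : I, s ≤ t →
    HasLaw (fun ω ↦ coord t ω - coord s ω) (gaussianReal 0 (Real.toNNReal ((t : ℝ) - s))) W

section LocalScales

variable {X : Type*} [PseudoMetricSpace X] [MeasurableSpace X]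

/-- The lower local scale of `μ` at `x` for a family `(scl α)_{α > 0}` of gauge functions:
`sup {α > 0 : μ (B(x, ε)) / scl α ε → 0 as ε → 0⁺}`, an element of `[0, ∞]` (`sup ∅ = 0`). -/
noncomputable def lowerLocalScale (scl : ℝ → ℝ → ℝ) (μ : Measure X) (x : X) : ℝ≥0∞ :=
  sSup (ENNReal.ofReal '' {α : ℝ | 0 < α ∧
    Tendsto (fun ε : ℝ ↦ μ (Metric.ball x ε) / ENNReal.ofReal (scl α ε)) (𝓝[>] 0) (𝓝 0)})

/-- The upper local scale of `μ` at `x` for a family `(scl α)_{α > 0}` of gauge functions: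
`inf {α > 0 : μ (B(x, ε)) / scl α ε → +∞ as ε → 0⁺}`, an element of `[0, ∞]` (`inf ∅ = ∞`). -/
noncomputable def upperLocalScale (scl : ℝ → ℝ → ℝ) (μ : Measure X) (x : X) : ℝ≥0∞ :=
  sInf (ENNReal.ofReal '' {α : ℝ | 0 < α ∧
    Tendsto (fun ε : ℝ ↦ μ (Metric.ball x ε) / ENNReal.ofReal (scl α ε)) (𝓝[>] 0) (𝓝 ∞)})

/-- The scaling `ord = (ε ↦ exp (-ε ^ (-α)))_{α > 0}`; only its values at `ε > 0` matter. -/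
noncomputable def ord (α ε : ℝ) : ℝ := Real.exp (-ε ^ (-α))

/-- The lower local order of `μ` at `x`. -/
noncomputable def lowerLocalOrder (μ : Measure X) (x : X) : ℝ≥0∞ := lowerLocalScale ord μ x

/-- The upper local order of `μ` at `x`. -/
noncomputable def upperLocalOrder (μ : Measure X) (x : X) : ℝ≥0∞ := upperLocalScale ord μ x

/-- The level set of points at which the lower local order equals `a`. -/
def lowerLevelSet (μ : Measure X) (a : ℝ≥0∞) : Set X := {x | lowerLocalOrder μ x = a}

/-- The level set of points at which the upper local order equals `a`. -/
def upperLevelSet (μ : Measure X) (a : ℝ≥0∞) : Set X := {x | upperLocalOrder μ x = a}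

/-- The level set of points at which the local order exists (the lower and upper local orders
coincide) and equals `a`. -/
def levelSet (μ : Measure X) (a : ℝ≥0∞) : Set X := lowerLevelSet μ a ∩ upperLevelSet μ a

end LocalScales

end WienerOrder

namespace WienerOrder

/-! A path within `ε` of `ω` has its `n` increments over the uniform grid within `2 * ε` of those of
`ω`. These increments are independent Gaussians of variance `1 / n`, with density at most `√n`, so
the ball has measure at most `(4 * ε * √n) ^ n` (`measure_ball_le_pow`), whatever the centre. Taking
`n` of order `ε ^ (-2)` keeps the base below `exp (-1)` and yields a bound `exp (1 - c / ε ^ 2)`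
(`measure_ball_le_exp`), negligible against `exp (-ε ^ (-α))` for every `α < 2`. Both orders are
then at least `2`. -/

/-- A Gaussian measure gives a ball of radius `r` at most its length over the standard deviation. -/
lemma gaussianReal_ball_le (m : ℝ) {v : NNReal} (hv : v ≠ 0) (x r : ℝ) :
    gaussianReal m v (Metric.ball x r) ≤ ENNReal.ofReal (2 * r / √v) := by
  have hv' : (0 : ℝ) < v := by positivity
  have hpdf : ∀ y, gaussianPDF m v y ≤ ENNReal.ofReal (√v)⁻¹ := fun y ↦ by
    refine ENNReal.ofReal_le_ofReal ?_
    have hexp : Real.exp (-(y - m) ^ 2 / (2 * v)) ≤ 1 := by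
      rw [Real.exp_le_one_iff, neg_div]
      exact neg_nonpos.2 (by positivity)
    have hsqrt : √(v : ℝ) ≤ √(2 * Real.pi * v) :=
      Real.sqrt_le_sqrt (le_mul_of_one_le_left hv'.le (by linarith [Real.pi_gt_three]))
    calc gaussianPDFReal m v y ≤ (√(2 * Real.pi * v))⁻¹ * 1 :=
          mul_le_mul_of_nonneg_left hexp (by positivity)
      _ ≤ (√v)⁻¹ := by
          rw [mul_one]
          exact inv_anti₀ (Real.sqrt_pos.2 hv') hsqrt
  rw [gaussianReal_apply m hv]
  calc ∫⁻ y in Metric.ball x r, gaussianPDF m v y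
      ≤ ∫⁻ _ in Metric.ball x r, ENNReal.ofReal (√v)⁻¹ := lintegral_mono hpdf
    _ = ENNReal.ofReal (2 * r / √v) := by
      rw [setLIntegral_const, Real.volume_ball, ← ENNReal.ofReal_mul (by positivity),
        div_eq_inv_mul]

/-- The `i`-th point of the uniform subdivision of `[0,1]` into `n` intervals. -/
noncomputable def gridPoint (n : ℕ) (i : Fin (n + 1)) : I :=
  ⟨(i : ℝ) / n, by positivity,
    div_le_one_of_le₀ (Nat.cast_le.2 (Nat.lt_succ_iff.1 i.2)) (by positivity)⟩

lemma gridPoint_monotone (n : ℕ) : Monotone (gridPoint n) := fun i j hij ↦ by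
  have : (i : ℕ) ≤ j := hij
  change (i : ℝ) / n ≤ (j : ℝ) / n
  gcongr

/-- The increments of a path in a ball of radius `ε` along the uniform subdivision lie in balls of
radius `2 * ε`; by independence, the measure of the ball is bounded by a product. -/
lemma IsWienerMeasure.measure_ball_le_pow {W : Measure PathSpace} (hW : IsWienerMeasure W)
    (ω : PathSpace) (ε : ℝ) {n : ℕ} (hn : n ≠ 0) :
    W (Metric.ball ω ε) ≤ ENNReal.ofReal (4 * ε * √n) ^ n := by
  set t := gridPoint n
  set Y : Fin n → PathSpace → ℝ := fun i ω' ↦ coord (t i.succ) ω' - coord (t i.castSucc) ω'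
  have hind : iIndepFun Y W := hW.hasIndepIncrements n t (gridPoint_monotone n)
  have hsub : Metric.ball ω ε ⊆
      ⋂ i ∈ (Finset.univ : Finset (Fin n)), Y i ⁻¹' Metric.ball (Y i ω) (2 * ε) := by
    intro ω' hω'
    simp only [Set.mem_iInter]
    intro i _
    have hcoord : ∀ s : I, |coord s ω' - coord s ω| < ε := fun s ↦
      (ContinuousMap.dist_apply_le_dist (f := ω'.1) (g := ω.1) s).trans_lt hω'
    have h₁ := abs_lt.1 (hcoord (t i.succ))
    have h₂ := abs_lt.1 (hcoord (t i.castSucc))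
    rw [Set.mem_preimage, Metric.mem_ball, Real.dist_eq, abs_lt]
    constructor <;> simp only [Y] <;> linarith
  refine (measure_mono hsub).trans ?_
  rw [hind.measure_inter_preimage_eq_mul _ fun i _ ↦ Metric.isOpen_ball.measurableSet]
  have hprob : ∀ i, W (Y i ⁻¹' Metric.ball (Y i ω) (2 * ε)) ≤ ENNReal.ofReal (4 * ε * √n) := by
    intro i
    have hlaw := hW.hasLaw_increment (t i.castSucc) (t i.succ)
      (gridPoint_monotone n i.castSucc_lt_succ.le)
    have hvar : ((t i.succ : I) : ℝ) - (t i.castSucc : I) = (n : ℝ)⁻¹ := by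
      simp only [t, gridPoint, Fin.val_succ, Fin.val_castSucc]
      push_cast
      ring
    rw [hvar] at hlaw
    have hpos : (0 : ℝ) < (n : ℝ)⁻¹ := by positivity
    rw [← Measure.map_apply_of_aemeasurable hlaw.aemeasurable Metric.isOpen_ball.measurableSet,
      hlaw.map_eq]
    refine (gaussianReal_ball_le 0 (Real.toNNReal_pos.2 hpos).ne' _ _).trans_eq ?_
    rw [Real.coe_toNNReal _ hpos.le, Real.sqrt_inv, div_inv_eq_mul]
    ring_nf
  exact (Finset.prod_le_prod' fun i _ ↦ hprob i).trans_eq (by simp)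

/-- Small balls have measure at most `exp (-c * ε ^ (-2))`, up to a constant factor. -/
lemma IsWienerMeasure.measure_ball_le_exp {W : Measure PathSpace} (hW : IsWienerMeasure W)
    (ω : PathSpace) {ε : ℝ} (hε : 0 < ε) (hε' : ε ≤ 1 / 16) :
    W (Metric.ball ω ε) ≤ ENNReal.ofReal (Real.exp (1 - 1 / (256 * ε ^ 2))) := by
  -- The number of increments is `⌊x⌋₊`: then `√⌊x⌋₊ ≤ 1 / (16 * ε)`, so the base is at most `1 / 4
  -- < exp (-1)`. The condition `ε ≤ 1 / 16` is what makes `x ≥ 1`, hence `⌊x⌋₊ ≠ 0`.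
  set x : ℝ := 1 / (256 * ε ^ 2) with hx
  have hx₁ : 1 ≤ x := by
    rw [hx, le_div_iff₀ (by positivity)]
    nlinarith
  have hn : ⌊x⌋₊ ≠ 0 := (Nat.floor_pos.2 hx₁).ne'
  have hsqrt : 4 * ε * √(⌊x⌋₊ : ℝ) ≤ Real.exp (-1) := by
    have hle : √(⌊x⌋₊ : ℝ) ≤ 1 / (16 * ε) := by
      refine (Real.sqrt_le_sqrt (Nat.floor_le (by linarith))).trans_eq ?_
      rw [hx, show 1 / (256 * ε ^ 2) = (1 / (16 * ε)) ^ 2 by ring, Real.sqrt_sq (by positivity)]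
    calc 4 * ε * √(⌊x⌋₊ : ℝ) ≤ 4 * ε * (1 / (16 * ε)) := by gcongr
      _ = 1 / 4 := by field_simp; norm_num
      _ ≤ Real.exp (-1) := by linarith [Real.exp_neg_one_gt_d9]
  refine (hW.measure_ball_le_pow ω ε hn).trans ?_
  rw [← ENNReal.ofReal_pow (by positivity)]
  refine ENNReal.ofReal_le_ofReal ?_
  calc (4 * ε * √(⌊x⌋₊ : ℝ)) ^ ⌊x⌋₊ ≤ Real.exp (-1) ^ ⌊x⌋₊ := by gcongr
    _ = Real.exp (-⌊x⌋₊) := by rw [← Real.exp_nat_mul, mul_neg_one]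
    -- Rounding `x` down costs less than `1`, whence the `1` in the exponent.
    _ ≤ Real.exp (1 - x) := Real.exp_le_exp.2 (by linarith [Nat.lt_floor_add_one x])

/-- This is the exponent of the ball bound divided by the gauge. It equals `1 + ε ^ (-2) * (-c + ε ^
(2 - α))`, whose bracket tends to `-c < 0`. -/
lemma tendsto_sub_inv_sq_add_rpow_neg {α c : ℝ} (hα : α < 2) (hc : 0 < c) :
    Tendsto (fun ε : ℝ ↦ 1 - c / ε ^ 2 + ε ^ (-α)) (𝓝[>] 0) atBot := by
  have hsq : Tendsto (fun ε : ℝ ↦ (ε ^ 2)⁻¹) (𝓝[>] 0) atTop := by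
    simpa only [inv_pow, Function.comp_def] using
      (tendsto_pow_atTop two_ne_zero).comp (tendsto_inv_nhdsGT_zero (𝕜 := ℝ))
  have hfac : Tendsto (fun ε : ℝ ↦ -c + ε ^ (2 - α)) (𝓝[>] 0) (𝓝 (-c)) := by
    have : Tendsto (fun ε : ℝ ↦ ε ^ (2 - α)) (𝓝 0) (𝓝 0) := by
      simpa [Real.zero_rpow (sub_pos.2 hα).ne'] using
        (Real.continuousAt_rpow_const 0 (2 - α) (Or.inr (sub_pos.2 hα).le)).tendsto
    simpa using (this.mono_left nhdsWithin_le_nhds).const_add (-c)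
  refine (tendsto_atBot_add_const_left _ 1
    (hsq.atTop_mul_neg (neg_neg_of_pos hc) hfac)).congr' ?_
  filter_upwards [self_mem_nhdsWithin] with ε (hε : 0 < ε)
  have hpow : (ε ^ 2)⁻¹ * ε ^ (2 - α) = ε ^ (-α) := by
    rw [← Real.rpow_natCast, ← Real.rpow_neg hε.le, ← Real.rpow_add hε]
    congr 1
    push_cast
    ring
  rw [mul_add, hpow]
  ring

/-- Below the exponent `2`, the Wiener measure of balls is negligible against the gauge. -/
lemma IsWienerMeasure.tendsto_measure_ball_div_ord {W : Measure PathSpace}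
    (hW : IsWienerMeasure W) (ω : PathSpace) {α : ℝ} (hα : α < 2) :
    Tendsto (fun ε : ℝ ↦ W (Metric.ball ω ε) / ENNReal.ofReal (ord α ε)) (𝓝[>] 0) (𝓝 0) := by
  have hlim : Tendsto (fun ε : ℝ ↦ ENNReal.ofReal
      (Real.exp (1 - (1 / 256) / ε ^ 2 + ε ^ (-α)))) (𝓝[>] 0) (𝓝 0) := by
    simpa using ENNReal.tendsto_ofReal (Real.tendsto_exp_atBot.comp
      (tendsto_sub_inv_sq_add_rpow_neg hα (by norm_num : (0 : ℝ) < 1 / 256)))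
  refine tendsto_of_tendsto_of_tendsto_of_le_of_le' tendsto_const_nhds hlim
    (Eventually.of_forall fun _ ↦ zero_le) ?_
  filter_upwards [Ioc_mem_nhdsGT (by norm_num : (0 : ℝ) < 1 / 16)] with ε hε
  refine (ENNReal.div_le_div_right (hW.measure_ball_le_exp ω hε.1 hε.2) _).trans_eq ?_
  rw [ord, ← ENNReal.ofReal_div_of_pos (Real.exp_pos _), ← Real.exp_sub, div_div, sub_neg_eq_add]

lemma IsWienerMeasure.two_le_lowerLocalOrder {W : Measure PathSpace} (hW : IsWienerMeasure W)
    (ω : PathSpace) : 2 ≤ lowerLocalOrder W ω := by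
  refine le_of_forall_lt fun a ha ↦ ?_
  -- Any exponent strictly between `a` and `2` is admissible in the supremum; `a < b` also makes it
  -- positive.
  obtain ⟨b, hab, hb⟩ := exists_between ha
  have hbtop : b ≠ ∞ := (hb.trans ENNReal.ofNat_lt_top).ne
  refine hab.trans_le (le_sSup ⟨b.toReal, ⟨?_, ?_⟩, ENNReal.ofReal_toReal hbtop⟩)
  · exact ENNReal.toReal_pos (zero_le.trans_lt hab).ne' hbtop
  · refine hW.tendsto_measure_ball_div_ord ω ?_
    simpa using (ENNReal.toReal_lt_toReal hbtop ENNReal.ofNat_ne_top).2 hb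

/-- For `α < 2` the ratio tends to `0`, so it cannot also tend to `∞`: no such `α` enters the
infimum. -/
lemma IsWienerMeasure.two_le_upperLocalOrder {W : Measure PathSpace} (hW : IsWienerMeasure W)
    (ω : PathSpace) : 2 ≤ upperLocalOrder W ω := by
  refine le_sInf ?_
  rintro _ ⟨α, ⟨-, hlim⟩, rfl⟩
  have hα : 2 ≤ α := by
    by_contra! h
    exact ENNReal.zero_ne_top
      (tendsto_nhds_unique (hW.tendsto_measure_ball_div_ord ω h) hlim)
  simpa using ENNReal.ofReal_le_ofReal hα

end WienerOrder

theorem mainTheorem11 (W : Measure WienerOrder.PathSpace)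
    (hW : WienerOrder.IsWienerMeasure W) :
    (∀ ω : WienerOrder.PathSpace,
      2 ≤ WienerOrder.lowerLocalOrder W ω ∧ 2 ≤ WienerOrder.upperLocalOrder W ω) ∧
    (∀ a : ℝ≥0∞, a < 2 →
      WienerOrder.lowerLevelSet W a = ∅ ∧
      WienerOrder.upperLevelSet W a = ∅ ∧
      WienerOrder.levelSet W a = ∅) := by
  have hlower : ∀ a : ℝ≥0∞, a < 2 → WienerOrder.lowerLevelSet W a = ∅ := fun a ha ↦
    Set.eq_empty_of_forall_notMem fun ω hω ↦
      (ha.trans_le (hW.two_le_lowerLocalOrder ω)).ne' hω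
  have hupper : ∀ a : ℝ≥0∞, a < 2 → WienerOrder.upperLevelSet W a = ∅ := fun a ha ↦
    Set.eq_empty_of_forall_notMem fun ω hω ↦
      (ha.trans_le (hW.two_le_upperLocalOrder ω)).ne' hω
  refine ⟨fun ω ↦ ⟨hW.two_le_lowerLocalOrder ω, hW.two_le_upperLocalOrder ω⟩, fun a ha ↦
    ⟨hlower a ha, hupper a ha, ?_⟩⟩
  rw [WienerOrder.levelSet, hlower a ha, Set.empty_inter]
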